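/- Let $n\ge 3$ be odd, let $A=[a_{ij}]\in\mathbb{R}^{n\times n}$ be a (row-)stochastic matrix, and let $P_k^+,P_k^-\in[0,1-\varepsilon]$ for all $k\ge 0$, where $0<\varepsilon<1$ is fixed. Consider the following randomized gossip algorithm on the nodes $1,\dots,n$. At each time $k\ge 0$ a node $i$ is drawn with probability $1/n$ and then picks a node $j$ with probability $a_{ij}$, so that the ordered pair $(i,j)$ is selected with probability $a_{ij}/n$. Let $\mathbb{E}_k^+$, with $\mathbf{P}(\mathbb{E}_k^+)=P_k^+$, be the event that node $i$ receives $x_j(k)$ when $(i,j)$ is selected at time $k$, and let $\mathbb{E}_k^-$, with $\mathbf{P}(\mathbb{E}_k^-)=P_k^-$, be the event that node $j$ receives $x_i(k)$ when $(i,j)$ is selected at time $k$. The pair selections at the different times and the communications $(\mathbb{E}_k^+,\mathbb{E}_k^-)$ at the different times are all mutually independent. A node that receives the state of the other node of the selected pair replaces its own state by the average of the two states; all other nodes keep their states. For $k_0\ge 0$ and $x^0\in\mathbb{R}^n$, let $x(k)=(x_1(k),\dots,x_n(k))$, $k\ge k_0$, be the resulting random process with $x(k_0)=x^0$, and put $x_{\rm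 ave}=\frac1n\sum_{i=1}^n x_i(k_0)$. A consensus limit exists for $(k_0,x^0)$ if there is a random variable $\xi$ with $\lim_{k\to\infty}x_i(k)=\xi$ almost surely for every $i$. Suppose that the communication is independent, i.e. for every $k$ the events $\mathbb{E}_k^+$ and $\mathbb{E}_k^-$ are independent. Then for every $k_0\ge 0$ and for Lebesgue-almost every initial condition $x^0=x(k_0)\in\mathbb{R}^n$: if the consensus limit exists, then $$\mathbf{P}\Big(\sum_{i=1}^n x_i(k)=n\,x_{\rm ave}\ \text{ for all } k\ge k_0\Big)=0 .$$ More generally, whether or not the consensus limit exists almost surely, for Lebesgue-almost every $x^0$ the event that $\sum_{i=1}^n x_i(k)=n\,x_{\rm ave}$ for all $k\ge k_0$ and that $x_1(k),\dots,x_n(k)$ converge to one common limit as $k\to\infty$ has probability zero. -/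

import Mathlib

open MeasureTheory ProbabilityTheory Filter Topology

/-- `pair k` is the ordered pair of nodes selected at time `k`: `pair k ω = (i, j)` means that
node `i` is drawn and picks node `j`. `Eplus k` is the event that the communication towards the
node that was drawn succeeds at time `k` (if `(i, j)` is selected, `i` receives `x_j(k)`), and
`Eminus k` the event that the communication towards the node that was picked succeeds (if
`(i, j)` is selected, `j` receives `x_i(k)`).

No relation between `Eplus k` and `Eminus k` at the same time `k` is imposed here. -/
structure IsGossipProcess {n : ℕ} {Ω : Type*} [MeasurableSpace Ω] (μ : Measure Ω)
    (A : Matrix (Fin n) (Fin n) ℝ) (Pplus Pminus : ℕ → ℝ)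
    (pair : ℕ → Ω → Fin n × Fin n) (Eplus Eminus : ℕ → Set Ω) : Prop where
  measurable_pair : ∀ k, Measurable (pair k)
  measurableSet_plus : ∀ k, MeasurableSet (Eplus k)
  measurableSet_minus : ∀ k, MeasurableSet (Eminus k)
  /-- A node `i` is drawn with probability `1 / n`, and then picks `j` with probability `A i j`. -/
  prob_pair : ∀ k i j, μ.real {ω | pair k ω = (i, j)} = 1 / (n : ℝ) * A i j
  prob_plus : ∀ k, μ.real (Eplus k) = Pplus k
  prob_minus : ∀ k, μ.real (Eminus k) = Pminus k
  /-- The selections at the different times and the communications at the different times are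
  all mutually independent. -/
  indep : iIndep (fun t : ℕ ⊕ ℕ => Sum.elim
    (fun k => MeasurableSpace.comap (pair k) inferInstance)
    (fun k => MeasurableSpace.generateFrom {Eplus k, Eminus k}) t) μ

open Classical in
/-- One step of the gossip algorithm from the state `x`, when the pair `p = (i, j)` is selected,
`plus` says whether `i` receives `x j` and `minus` whether `j` receives `x i`. A node that
receives the other state moves to the average; all other nodes keep their states. -/
noncomputable def gossipStep {n : ℕ} (p : Fin n × Fin n) (plus minus : Prop)
    (x : Fin n → ℝ) : Fin n → ℝ := fun i =>
  if i = p.1 ∧ plus then x i / 2 + x p.2 / 2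
  else if i = p.2 ∧ minus then x i / 2 + x p.1 / 2
  else x i

/-- The state `x(k; k₀, x⁰)` of the algorithm started at time `k₀` from `x⁰`, along the sample
`ω`. It is meant for `k ≥ k₀`; for `k ≤ k₀` it equals `x⁰`. -/
noncomputable def gossipState {n : ℕ} {Ω : Type*} (pair : ℕ → Ω → Fin n × Fin n)
    (Eplus Eminus : ℕ → Set Ω) (k₀ : ℕ) (x₀ : Fin n → ℝ) (ω : Ω) : ℕ → Fin n → ℝ
  | 0 => x₀
  | k + 1 =>
    if k₀ ≤ k then
      gossipStep (pair k ω) (ω ∈ Eplus k) (ω ∈ Eminus k)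
        (gossipState pair Eplus Eminus k₀ x₀ ω k)
    else x₀

/-- The average `(∑ i, x i) / n` of the states. -/
noncomputable def stateAverage {n : ℕ} (x : Fin n → ℝ) : ℝ := (∑ i, x i) / n

/-- The random variable `ξ` is the consensus limit of the algorithm started at time `k₀` from
`x₀`: the states of all nodes converge to `ξ` almost surely. -/
def IsConsensusLimit {n : ℕ} {Ω : Type*} [MeasurableSpace Ω] (μ : Measure Ω)
    (pair : ℕ → Ω → Fin n × Fin n) (Eplus Eminus : ℕ → Set Ω) (k₀ : ℕ) (x₀ : Fin n → ℝ)
    (ξ : Ω → ℝ) : Prop :=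
  Measurable ξ ∧ ∀ i, ∀ᵐ ω ∂μ,
    Tendsto (fun k => gossipState pair Eplus Eminus k₀ x₀ ω k i) atTop (𝓝 (ξ ω))

/-- The event that the sum of the states equals `n` times the initial average at all times
`k ≥ k₀`. -/
def sumPreserved {n : ℕ} {Ω : Type*} (pair : ℕ → Ω → Fin n × Fin n)
    (Eplus Eminus : ℕ → Set Ω) (k₀ : ℕ) (x₀ : Fin n → ℝ) : Set Ω :=
  {ω | ∀ k ≥ k₀, ∑ i, gossipState pair Eplus Eminus k₀ x₀ ω k i = n * stateAverage x₀}

/-- The event that the states of all nodes converge to one common limit. -/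
def consensusEvent {n : ℕ} {Ω : Type*} (pair : ℕ → Ω → Fin n × Fin n)
    (Eplus Eminus : ℕ → Set Ω) (k₀ : ℕ) (x₀ : Fin n → ℝ) : Set Ω :=
  {ω | ∃ c : ℝ, ∀ i,
    Tendsto (fun k => gossipState pair Eplus Eminus k₀ x₀ ω k i) atTop (𝓝 c)}

/-! After finitely many steps every state is a combination of the initial states with dyadic
coefficients. Since `n` is odd and at least 3, `1 / n` is not dyadic, so for almost every initial
vector no such combination equals the average: consensus on the average cannot be reached in finite
time.

Call an exchange effective if the selected states differ. An effective exchange in which exactly one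
node receives changes the sum. So preserving the sum while converging requires infinitely many
effective two-sided exchanges and no effective one-sided one.

Given the past and the selected pair, independence of the two communications makes a one-sided
outcome at least `ε` times as likely as a two-sided one. Multiply a weight by `1 + ε` at each
effective two-sided exchange and kill it at an effective one-sided one: its expectation never
exceeds 1, yet it tends to infinity on the bad event, which is null by Fatou. -/

/-! ### A one-sided Borel–Cantelli argument -/

/-- The weight `∏ l < k, f l`, where the factor `f l ω` is `0` if `ω ∈ C l`, `1 + δ` if
`ω ∈ B l \ C l`, and `1` otherwise. -/
noncomputable def survivalWeight {Ω : Type*} (δ : ENNReal) (B C : ℕ → Set Ω) (k : ℕ) (ω : Ω) :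
    ENNReal :=
  ∏ l ∈ Finset.range k, (1 + (B l).indicator (fun _ => δ) ω) * (C l)ᶜ.indicator (fun _ => 1) ω

theorem survivalWeight_succ {Ω : Type*} (δ : ENNReal) (B C : ℕ → Set Ω) (k : ℕ) (ω : Ω) :
    survivalWeight δ B C (k + 1) ω = survivalWeight δ B C k ω *
      ((1 + (B k).indicator (fun _ => δ) ω) * (C k)ᶜ.indicator (fun _ => 1) ω) :=
  Finset.prod_range_succ _ _

/-- One-step balance of gain and loss, with the loss moved to the left because subtraction in
`ENNReal` truncates. -/
theorem survivalWeight_succ_add {Ω : Type*} (δ : ENNReal) {B C : ℕ → Set Ω} {k : ℕ}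
    (h : Disjoint (B k) (C k)) (ω : Ω) :
    survivalWeight δ B C (k + 1) ω +
        survivalWeight δ B C k ω * (C k).indicator (fun _ => 1) ω =
      survivalWeight δ B C k ω +
        δ * (survivalWeight δ B C k ω * (B k).indicator (fun _ => 1) ω) := by
  rw [survivalWeight_succ]
  by_cases hC : ω ∈ C k
  · have hB : ω ∉ B k := fun hB => Set.disjoint_left.1 h hB hC
    simp [hB, hC]
  · by_cases hB : ω ∈ B k
    · simp [hB, hC]; ring
    · simp [hB, hC]

theorem measurable_survivalWeight {Ω : Type*} {δ : ENNReal} {B C : ℕ → Set Ω}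
    {h : ℕ → MeasurableSpace Ω} (hmono : Monotone h)
    (hB : ∀ k, MeasurableSet[h (k + 1)] (B k)) (hC : ∀ k, MeasurableSet[h (k + 1)] (C k)) (k : ℕ) :
    Measurable[h k] (survivalWeight δ B C k) := by
  refine Finset.measurable_fun_prod _ fun l hl => ?_
  have hle : h (l + 1) ≤ h k := hmono (Finset.mem_range.1 hl)
  have h1 : Measurable[h k] ((B l).indicator fun _ => δ) :=
    Measurable.indicator measurable_const (hle _ (hB l))
  have h2 : Measurable[h k] ((C l)ᶜ.indicator fun _ => (1 : ENNReal)) :=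
    Measurable.indicator measurable_const (hle _ (hC l)).compl
  exact (h1.const_add 1).mul h2

theorem tendsto_survivalWeight {Ω : Type*} {δ : ENNReal} (hδ : 0 < δ) {B C : ℕ → Set Ω} {ω : Ω}
    (hB : ∃ᶠ k in atTop, ω ∈ B k) (hC : ∀ k, ω ∉ C k) :
    Tendsto (fun k => survivalWeight δ B C k ω) atTop (𝓝 ⊤) := by
  have hsucc : ∀ k, survivalWeight δ B C (k + 1) ω =
      survivalWeight δ B C k ω * (1 + (B k).indicator (fun _ => δ) ω) := fun k => by
    rw [survivalWeight_succ]; simp [hC k]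
  have hmono : Monotone fun k => survivalWeight δ B C k ω :=
    monotone_nat_of_le_succ fun k => by
      rw [hsucc]; exact le_mul_of_one_le_right' le_self_add
  have hpow : ∀ N : ℕ, ∃ k, (1 + δ) ^ N ≤ survivalWeight δ B C k ω := by
    intro N
    induction N with
    | zero => exact ⟨0, by simp [survivalWeight]⟩
    | succ N ih =>
      obtain ⟨k, hk⟩ := ih
      obtain ⟨l, hkl, hl⟩ := frequently_atTop.1 hB k
      refine ⟨l + 1, ?_⟩
      rw [hsucc, pow_succ, Set.indicator_of_mem hl]
      exact mul_le_mul' (hk.trans (hmono hkl)) le_rfl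
  have hsup : ⨆ k, survivalWeight δ B C k ω = ⊤ := by
    have ht := ENNReal.tendsto_pow_atTop_nhds_top_iff.2
      (show 1 < 1 + δ from ENNReal.lt_add_right ENNReal.one_ne_top hδ.ne')
    refine top_le_iff.1 (le_of_tendsto' ht fun N => ?_)
    obtain ⟨k, hk⟩ := hpow N
    exact hk.trans (le_iSup (fun k => survivalWeight δ B C k ω) k)
  exact hsup ▸ tendsto_atTop_iSup hmono

/-- A one-sided conditional Borel–Cantelli lemma: let `M k` be known before time `k` (it belongs to
`h k`), and let the events `B k` and `C k` at time `k` be disjoint and independent of `h k`, with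
`P (C k)` at least a fixed multiple of `P (B k)`. Then almost surely it does not happen that
`M k ∩ B k` occurs infinitely often while `M k ∩ C k` never occurs. -/
theorem measure_frequently_inter_never_eq_zero {Ω : Type*} [mΩ : MeasurableSpace Ω]
    {μ : Measure Ω} [IsProbabilityMeasure μ] {h e : ℕ → MeasurableSpace Ω} (hmono : Monotone h)
    (hle : ∀ k, h k ≤ mΩ) (he : ∀ k, e k ≤ h (k + 1)) (hind : ∀ k, Indep (h k) (e k) μ)
    {M B C : ℕ → Set Ω} (hM : ∀ k, MeasurableSet[h k] (M k))
    (hB : ∀ k, MeasurableSet[e k] (B k)) (hC : ∀ k, MeasurableSet[e k] (C k))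
    (hBC : ∀ k, Disjoint (B k) (C k)) {δ : ENNReal} (hδ : 0 < δ)
    (hle_prob : ∀ k, δ * μ (B k) ≤ μ (C k)) :
    μ {ω | (∃ᶠ k in atTop, ω ∈ M k ∩ B k) ∧ ∀ k, ω ∉ M k ∩ C k} = 0 := by
  set V := survivalWeight δ (fun k => M k ∩ B k) (fun k => M k ∩ C k) with hV
  have hMsucc : ∀ k, MeasurableSet[h (k + 1)] (M k) := fun k => hmono k.le_succ _ (hM k)
  have hVm : ∀ k, Measurable[h k] (V k) := measurable_survivalWeight hmono
    (fun k => (hMsucc k).inter (he k _ (hB k))) (fun k => (hMsucc k).inter (he k _ (hC k)))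
  have hVm' : ∀ k, Measurable (V k) := fun k => (hVm k).mono (hle k) le_rfl
  have hprod : ∀ k (D : Set Ω), MeasurableSet[e k] D →
      ∫⁻ ω, V k ω * (M k ∩ D).indicator (fun _ => 1) ω ∂μ =
        (∫⁻ ω, V k ω * (M k).indicator (fun _ => 1) ω ∂μ) * μ D := by
    intro k D hD
    have hDm : MeasurableSet D := hle _ _ (he k _ hD)
    have hprod := lintegral_mul_eq_lintegral_mul_lintegral_of_independent_measurableSpace (hle k)
      ((he k).trans (hle _)) (hind k) ((hVm k).mul (measurable_const.indicator (hM k)) :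
        Measurable[h k] fun ω => V k ω * (M k).indicator (fun _ => 1) ω)
      (measurable_const.indicator hD : Measurable[e k] (D.indicator fun _ => (1 : ENNReal)))
    rw [lintegral_indicator_const hDm, one_mul] at hprod
    refine Eq.trans ?_ hprod
    refine lintegral_congr fun ω => ?_
    by_cases h1 : ω ∈ M k <;> by_cases h2 : ω ∈ D <;> simp [h1, h2]
  -- The expectation is nonincreasing: the expected gain `δ * a * μ (B k)` is at most the expected
  -- loss `a * μ (C k)`, a finite quantity that can be cancelled.
  have hint : ∀ k, ∫⁻ ω, V k ω ∂μ ≤ 1 := by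
    intro k
    induction k with
    | zero => simp [hV, survivalWeight]
    | succ k ih =>
      refine le_trans ?_ ih
      set a := ∫⁻ ω, V k ω * (M k).indicator (fun _ => 1) ω ∂μ with ha
      have ha1 : a ≤ 1 := (lintegral_mono fun ω =>
        mul_le_of_le_one_right' (Set.indicator_le_self' (by simp) ω)).trans ih
      have hB' : MeasurableSet (M k ∩ B k) :=
        (hle _ _ (hM k)).inter (hle _ _ (he k _ (hB k)))
      have key := lintegral_congr (μ := μ) (survivalWeight_succ_add δ
        (B := fun k => M k ∩ B k) (C := fun k => M k ∩ C k) (k := k)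
        ((hBC k).mono Set.inter_subset_right Set.inter_subset_right))
      rw [lintegral_add_left (hVm' _), lintegral_add_left (hVm' _),
        lintegral_const_mul _ (by exact (hVm' k).mul (measurable_const.indicator hB')),
        hprod k _ (hC k), hprod k _ (hB k)] at key
      have hfin : a * μ (C k) ≠ ⊤ :=
        ENNReal.mul_ne_top (ha1.trans_lt ENNReal.one_lt_top).ne (measure_ne_top _ _)
      refine (ENNReal.add_le_add_iff_right hfin).1 (key.trans_le ?_)
      rw [mul_left_comm]
      gcongr
      exact hle_prob k
  have hfatou : ∫⁻ ω, liminf (fun k => V k ω) atTop ∂μ ≤ 1 :=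
    (lintegral_liminf_le hVm').trans
      (liminf_le_of_frequently_le' (Frequently.of_forall hint))
  have hae := ae_lt_top (Measurable.liminf hVm') (hfatou.trans_lt ENNReal.one_lt_top).ne
  refine measure_mono_null (fun ω hω => ?_) (ae_iff.1 hae)
  simp [(tendsto_survivalWeight hδ hω.1 hω.2).liminf_eq, hV]

/-! ### Generic initial conditions -/

theorem ae_sum_mul_ne_zero {ι : Type*} [Fintype ι] {c : ι → ℝ} (hc : c ≠ 0) :
    ∀ᵐ x : ι → ℝ ∂volume, ∑ i, c i * x i ≠ 0 := by
  classical
  set f : (ι → ℝ) →ₗ[ℝ] ℝ := Fintype.linearCombination ℝ c with hf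
  have hfx : ∀ x, f x = ∑ i, c i * x i := fun x => by
    simp [hf, Fintype.linearCombination_apply, mul_comm]
  have hker : LinearMap.ker f ≠ ⊤ := by
    intro h
    refine hc (funext fun i => ?_)
    have : f (Pi.single i 1) = 0 := LinearMap.mem_ker.1 (h ▸ Submodule.mem_top)
    simpa [hfx, Pi.single_apply] using this
  refine measure_mono_null (fun x hx => ?_) (Measure.addHaar_submodule volume _ hker)
  simpa [hfx] using hx

/-- A dyadic combination of the coordinates of a generic vector is never their average. -/
theorem ae_dyadic_combination_ne_average {n : ℕ} (hn : 3 ≤ n) (hodd : Odd n) :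
    ∀ᵐ x : Fin n → ℝ ∂volume, ∀ (a : Fin n → ℤ) (m : ℕ),
      (n : ℝ) * ∑ j, (a j : ℝ) * x j ≠ 2 ^ m * ∑ j, x j := by
  rw [ae_all_iff]
  intro a
  rw [ae_all_iff]
  intro m
  -- A zero coefficient would make the odd number `n ≥ 3` divide a power of 2.
  have hc : (fun j => (n : ℝ) * a j - 2 ^ m) ≠ 0 := by
    intro h
    have h0 := congrFun h ⟨0, by omega⟩
    have h1 : (n : ℤ) * a ⟨0, by omega⟩ = 2 ^ m := by
      have : (n : ℝ) * a ⟨0, by omega⟩ = 2 ^ m := sub_eq_zero.1 h0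
      exact_mod_cast this
    have hdvd : n ∣ 2 ^ m := by
      have : (n : ℤ) ∣ 2 ^ m := ⟨_, h1.symm⟩
      exact_mod_cast this
    have hcop : n.Coprime (2 ^ m) := (Nat.coprime_two_right.2 hodd).pow_right m
    have := Nat.Coprime.eq_one_of_dvd hcop hdvd
    omega
  filter_upwards [ae_sum_mul_ne_zero hc] with x hx h
  refine hx ?_
  simp only [sub_mul, Finset.sum_sub_distrib, mul_assoc, ← Finset.mul_sum]
  linarith

/-! ### Deterministic analysis of sample paths -/

theorem gossipStep_of_eq {n : ℕ} {p : Fin n × Fin n} {plus minus : Prop} {x : Fin n → ℝ}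
    (h : x p.1 = x p.2) : gossipStep p plus minus x = x := by
  funext i
  simp only [gossipStep]
  split_ifs with h1 h2
  · rw [h1.1, h]; ring
  · rw [h2.1, h]; ring
  · rfl

theorem gossipStep_of_not {n : ℕ} {p : Fin n × Fin n} {plus minus : Prop} {x : Fin n → ℝ}
    (hp : ¬plus) (hm : ¬minus) : gossipStep p plus minus x = x := by
  funext i
  simp [gossipStep, hp, hm]

/-- Exactly one coordinate moves, by half of a nonzero difference. -/
theorem sum_gossipStep_ne {n : ℕ} {p : Fin n × Fin n} {plus minus : Prop} {x : Fin n → ℝ}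
    (h : x p.1 ≠ x p.2) (hpm : plus ∧ ¬minus ∨ minus ∧ ¬plus) :
    ∑ i, gossipStep p plus minus x i ≠ ∑ i, x i := by
  rw [← sub_ne_zero, ← Finset.sum_sub_distrib]
  rcases hpm with ⟨hp, hm⟩ | ⟨hm, hp⟩
  · rw [Finset.sum_eq_single p.1 (fun i _ hi => by simp [gossipStep, hi, hm]) (by simp)]
    simp only [gossipStep, hp, and_self, if_true]
    intro h0; exact h (by linarith)
  · rw [Finset.sum_eq_single p.2 (fun i _ hi => by simp [gossipStep, hi, hp]) (by simp)]
    simp only [gossipStep, hp, hm, and_false, and_self, if_true, if_false]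
    intro h0; exact h (by linarith)

/-- Each state is a combination of the initial states with coefficients in `2 ^ (-k) ℤ`. -/
theorem exists_dyadic_gossipState {n : ℕ} {Ω : Type*} (pair : ℕ → Ω → Fin n × Fin n)
    (Eplus Eminus : ℕ → Set Ω) (k₀ : ℕ) (x₀ : Fin n → ℝ) (ω : Ω) (k : ℕ) (i : Fin n) :
    ∃ a : Fin n → ℤ,
      2 ^ k * gossipState pair Eplus Eminus k₀ x₀ ω k i = ∑ j, (a j : ℝ) * x₀ j := by
  classical
  have hinit : ∀ (k : ℕ) (i : Fin n), ∃ a : Fin n → ℤ,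
      2 ^ k * x₀ i = ∑ j, (a j : ℝ) * x₀ j := fun k i =>
    ⟨Pi.single i (2 ^ k), by simp [Pi.single_apply]⟩
  induction k generalizing i with
  | zero => exact hinit 0 i
  | succ k ih =>
    have havg : ∀ i j, ∃ a : Fin n → ℤ,
        2 ^ (k + 1) * (gossipState pair Eplus Eminus k₀ x₀ ω k i / 2 +
          gossipState pair Eplus Eminus k₀ x₀ ω k j / 2) = ∑ j, (a j : ℝ) * x₀ j := by
      intro i j
      obtain ⟨a, ha⟩ := ih i
      obtain ⟨b, hb⟩ := ih j
      refine ⟨a + b, ?_⟩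
      simp only [Pi.add_apply, Int.cast_add, add_mul, Finset.sum_add_distrib, ← ha, ← hb]
      ring
    rw [gossipState]
    split_ifs
    · simp only [gossipStep]
      split_ifs
      · exact havg _ _
      · exact havg _ _
      -- An unchanged state is its average with itself.
      · obtain ⟨a, ha⟩ := havg i i
        exact ⟨a, by rw [← ha]; ring⟩
    · exact hinit (k + 1) i

theorem gossipState_succ {n : ℕ} {Ω : Type*} (pair : ℕ → Ω → Fin n × Fin n)
    (Eplus Eminus : ℕ → Set Ω) {k₀ : ℕ} (x₀ : Fin n → ℝ) (ω : Ω) {k : ℕ} (hk : k₀ ≤ k) :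
    gossipState pair Eplus Eminus k₀ x₀ ω (k + 1) =
      gossipStep (pair k ω) (ω ∈ Eplus k) (ω ∈ Eminus k)
        (gossipState pair Eplus Eminus k₀ x₀ ω k) := by
  rw [gossipState, if_pos hk]

/-- The event that at time `k` the gossip is effective: the states of the two selected nodes
differ. -/
def distinctSelected {n : ℕ} {Ω : Type*} (pair : ℕ → Ω → Fin n × Fin n)
    (Eplus Eminus : ℕ → Set Ω) (k₀ : ℕ) (x₀ : Fin n → ℝ) (k : ℕ) : Set Ω :=
  {ω | k₀ ≤ k ∧ gossipState pair Eplus Eminus k₀ x₀ ω k (pair k ω).1 ≠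
    gossipState pair Eplus Eminus k₀ x₀ ω k (pair k ω).2}

theorem notMem_asymmetric_of_sumPreserved {n : ℕ} {Ω : Type*} {pair : ℕ → Ω → Fin n × Fin n}
    {Eplus Eminus : ℕ → Set Ω} {k₀ : ℕ} {x₀ : Fin n → ℝ} {ω : Ω}
    (h : ω ∈ sumPreserved pair Eplus Eminus k₀ x₀) (k : ℕ) :
    ω ∉ distinctSelected pair Eplus Eminus k₀ x₀ k ∩ symmDiff (Eplus k) (Eminus k) := by
  rintro ⟨⟨hk, hne⟩, hsd⟩
  refine sum_gossipStep_ne hne hsd ?_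
  rw [← gossipState_succ _ _ _ _ _ hk, h k hk]
  exact h (k + 1) (hk.trans k.le_succ)

/-- Otherwise the state freezes at some time `L`; convergence then forces all coordinates at `L` to
equal the average, which is not dyadic in `x₀`. -/
theorem frequently_symmetric_of_consensus {n : ℕ} (hn : 0 < n) {Ω : Type*}
    {pair : ℕ → Ω → Fin n × Fin n} {Eplus Eminus : ℕ → Set Ω} {k₀ : ℕ} {x₀ : Fin n → ℝ} {ω : Ω}
    (hx₀ : ∀ (a : Fin n → ℤ) (m : ℕ), (n : ℝ) * ∑ j, (a j : ℝ) * x₀ j ≠ 2 ^ m * ∑ j, x₀ j)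
    (h : ω ∈ sumPreserved pair Eplus Eminus k₀ x₀)
    (hc : ω ∈ consensusEvent pair Eplus Eminus k₀ x₀) :
    ∃ᶠ k in atTop, ω ∈ distinctSelected pair Eplus Eminus k₀ x₀ k ∩ (Eplus k ∩ Eminus k) := by
  intro hev
  obtain ⟨K, hK⟩ := eventually_atTop.1 hev
  set x := gossipState pair Eplus Eminus k₀ x₀ ω with hx
  set L := max K k₀ with hL
  have hstep : ∀ k, L ≤ k → x (k + 1) = x k := by
    intro k hk
    have hk₀ : k₀ ≤ k := (le_max_right _ _).trans hk
    rw [hx, gossipState_succ _ _ _ _ _ hk₀]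
    by_cases hne : x k (pair k ω).1 = x k (pair k ω).2
    · exact gossipStep_of_eq hne
    · have hD : ω ∈ distinctSelected pair Eplus Eminus k₀ x₀ k := ⟨hk₀, hne⟩
      have h1 := notMem_asymmetric_of_sumPreserved h k
      have h2 := hK k ((le_max_left _ _).trans hk)
      simp only [Set.mem_inter_iff, hD, true_and, Set.mem_symmDiff] at h1 h2
      exact gossipStep_of_not (by tauto) (by tauto)
  have hconst : ∀ k, L ≤ k → x k = x L := fun k hk => by
    induction k, hk using Nat.le_induction with
    | base => rfl
    | succ k hk ih => rw [hstep k hk, ih]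
  obtain ⟨c, hc⟩ := hc
  have hxc : ∀ i, x L i = c := fun i => by
    refine tendsto_nhds_unique (tendsto_const_nhds.congr' ?_) (hc i)
    filter_upwards [eventually_ge_atTop L] with k hk
    exact (congrFun (hconst k hk) i).symm
  have hsum : ∑ i, x L i = ∑ i, x₀ i := by
    rw [h L (le_max_right _ _), stateAverage, mul_div_cancel₀]
    exact_mod_cast hn.ne'
  simp only [hxc, Finset.sum_const, Finset.card_univ, Fintype.card_fin, nsmul_eq_mul] at hsum
  obtain ⟨a, ha⟩ := exists_dyadic_gossipState pair Eplus Eminus k₀ x₀ ω L ⟨0, hn⟩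
  refine hx₀ a L ?_
  rw [← ha, ← hx, hxc, ← hsum]
  ring

/-! ### Measurability with respect to the past -/

/-- The selections up to time `k` (included) and the communications before time `k`. -/
def knownIndices (k : ℕ) : Set (ℕ ⊕ ℕ) := {t | Sum.elim (· ≤ k) (· < k) t}

theorem monotone_knownIndices : Monotone knownIndices := by
  rintro k l hkl (t | t) ht
  · exact le_trans (b := k) ht hkl
  · exact lt_of_lt_of_le (b := k) ht hkl

theorem measurable_gossipStep {n : ℕ} {Ω : Type*} {m : MeasurableSpace Ω}
    {p : Ω → Fin n × Fin n} {plus minus : Set Ω} {x : Ω → Fin n → ℝ} (hp : Measurable p)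
    (hplus : MeasurableSet plus) (hminus : MeasurableSet minus) (hx : Measurable x) :
    Measurable fun ω => gossipStep (p ω) (ω ∈ plus) (ω ∈ minus) (x ω) := by
  have hF : Measurable fun q : ((Fin n × Fin n) × Prop × Prop) × (Fin n → ℝ) =>
      gossipStep q.1.1 q.1.2.1 q.1.2.2 q.2 := by
    -- Pair and outcomes take countably many values, so measurability in the state is checked for
    -- each value.
    refine measurable_from_prod_countable_right fun q => measurable_pi_lambda _ fun i => ?_
    simp only [gossipStep]
    split_ifs <;> fun_prop
  exact hF.comp ((hp.prodMk (hplus.mem.prodMk hminus.mem)).prodMk hx)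

theorem measurable_gossipState {n : ℕ} {Ω : Type*} {pair : ℕ → Ω → Fin n × Fin n}
    {Eplus Eminus : ℕ → Set Ω} (k₀ : ℕ) (x₀ : Fin n → ℝ) {h : ℕ → MeasurableSpace Ω}
    (hmono : Monotone h) (hpair : ∀ k, Measurable[h k] (pair k))
    (hplus : ∀ k, MeasurableSet[h (k + 1)] (Eplus k))
    (hminus : ∀ k, MeasurableSet[h (k + 1)] (Eminus k)) (k : ℕ) :
    Measurable[h k] fun ω => gossipState pair Eplus Eminus k₀ x₀ ω k := by
  induction k with
  | zero => exact measurable_const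
  | succ k ih =>
    have hle : h k ≤ h (k + 1) := hmono k.le_succ
    simp only [gossipState]
    split_ifs
    · exact measurable_gossipStep ((hpair k).mono hle le_rfl) (hplus k) (hminus k)
        (ih.mono hle le_rfl)
    · exact measurable_const

theorem measurableSet_distinctSelected {n : ℕ} {Ω : Type*} {m : MeasurableSpace Ω}
    {pair : ℕ → Ω → Fin n × Fin n} {Eplus Eminus : ℕ → Set Ω} {k₀ : ℕ} {x₀ : Fin n → ℝ} {k : ℕ}
    (hpair : Measurable (pair k))
    (hstate : Measurable fun ω => gossipState pair Eplus Eminus k₀ x₀ ω k) :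
    MeasurableSet (distinctSelected pair Eplus Eminus k₀ x₀ k) := by
  have hF : MeasurableSet {q : (Fin n × Fin n) × (Fin n → ℝ) | q.2 q.1.1 ≠ q.2 q.1.2} := by
    have h1 : Measurable fun q : (Fin n × Fin n) × (Fin n → ℝ) => q.2 q.1.1 :=
      measurable_from_prod_countable_right fun q => measurable_pi_apply q.1
    have h2 : Measurable fun q : (Fin n × Fin n) × (Fin n → ℝ) => q.2 q.1.2 :=
      measurable_from_prod_countable_right fun q => measurable_pi_apply q.2
    exact (measurableSet_eq_fun h1 h2).compl
  exact (MeasurableSet.const _).inter ((hpair.prodMk hstate) hF)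

/-! ### Probability estimate and conclusion -/

/-- By independence `s \ t` has probability `P(s) P(tᶜ) ≥ ε P(s)`, and `s ∩ t` has at most `P(s)`.
-/
theorem ofReal_mul_measure_inter_le_measure_symmDiff {Ω : Type*} [MeasurableSpace Ω]
    {μ : Measure Ω} [IsProbabilityMeasure μ] {s t : Set Ω}
    (ht : MeasurableSet t) (hst : IndepSet s t μ) {ε : ℝ} (htε : μ.real t ≤ 1 - ε) :
    ENNReal.ofReal ε * μ (s ∩ t) ≤ μ (symmDiff s t) := by
  have hsub : s \ t ⊆ symmDiff s t := Set.subset_union_left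
  refine le_trans ?_ (measure_mono hsub)
  have hmul : μ (s ∩ tᶜ) = μ s * μ tᶜ :=
    (Indep_iff _ _ μ).1 hst s tᶜ (MeasurableSpace.measurableSet_generateFrom (Set.mem_singleton _))
      (MeasurableSpace.measurableSet_generateFrom (Set.mem_singleton _)).compl
  have hc : ENNReal.ofReal ε ≤ μ tᶜ := by
    rw [ENNReal.ofReal_le_iff_le_toReal (measure_ne_top _ _)]
    have := probReal_compl_eq_one_sub (μ := μ) ht
    rw [Measure.real] at this
    linarith
  rw [Set.sdiff_eq, hmul, mul_comm]
  exact mul_le_mul' (measure_mono Set.inter_subset_left) hc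

theorem measure_sumPreserved_inter_consensusEvent_eq_zero {n : ℕ} (hn : 0 < n)
    {Ω : Type*} [mΩ : MeasurableSpace Ω] {μ : Measure Ω} [IsProbabilityMeasure μ]
    {A : Matrix (Fin n) (Fin n) ℝ} {Pplus Pminus : ℕ → ℝ}
    {pair : ℕ → Ω → Fin n × Fin n} {Eplus Eminus : ℕ → Set Ω}
    (hgossip : IsGossipProcess μ A Pplus Pminus pair Eplus Eminus)
    (hindep : ∀ k, IndepSet (Eplus k) (Eminus k) μ)
    {ε : ℝ} (hε₀ : 0 < ε) (hminus : ∀ k, Pminus k ≤ 1 - ε) (k₀ : ℕ) {x₀ : Fin n → ℝ}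
    (hx₀ : ∀ (a : Fin n → ℤ) (m : ℕ), (n : ℝ) * ∑ j, (a j : ℝ) * x₀ j ≠ 2 ^ m * ∑ j, x₀ j) :
    μ (sumPreserved pair Eplus Eminus k₀ x₀ ∩ consensusEvent pair Eplus Eminus k₀ x₀) = 0 := by
  set σ : ℕ ⊕ ℕ → MeasurableSpace Ω := Sum.elim
    (fun k => MeasurableSpace.comap (pair k) inferInstance)
    (fun k => MeasurableSpace.generateFrom {Eplus k, Eminus k}) with hσ
  have hσle : ∀ t, σ t ≤ mΩ := by
    rintro (k | k)
    · exact (hgossip.measurable_pair k).comap_le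
    · refine MeasurableSpace.generateFrom_le ?_
      rintro s (rfl | rfl)
      · exact hgossip.measurableSet_plus k
      · exact hgossip.measurableSet_minus k
  -- The pair selected at time `k` is included, so that effectiveness is known; the communications
  -- at time `k` are not, so that they stay independent of `h k`.
  set h : ℕ → MeasurableSpace Ω := fun k => ⨆ t ∈ knownIndices k, σ t with hh
  have hmono : Monotone h := fun k l hkl => biSup_mono (monotone_knownIndices hkl)
  have he : ∀ k, σ (Sum.inr k) ≤ h (k + 1) := fun k =>
    le_iSup₂_of_le (Sum.inr k) (show k < k + 1 from k.lt_succ_self) le_rfl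
  have hind : ∀ k, Indep (h k) (σ (Sum.inr k)) μ := fun k => by
    have := indep_iSup_of_disjoint hσle hgossip.indep (S := knownIndices k) (T := {Sum.inr k})
      (Set.disjoint_singleton_right.2 fun hk => lt_irrefl k hk)
    simpa only [Set.mem_singleton_iff, iSup_iSup_eq_left] using this
  have hP : ∀ k, MeasurableSet[σ (Sum.inr k)] (Eplus k) := fun k =>
    MeasurableSpace.measurableSet_generateFrom (Set.mem_insert _ _)
  have hQ : ∀ k, MeasurableSet[σ (Sum.inr k)] (Eminus k) := fun k =>
    MeasurableSpace.measurableSet_generateFrom (Set.mem_insert_of_mem _ rfl)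
  have hpair : ∀ k, Measurable[h k] (pair k) := fun k =>
    (comap_measurable (pair k)).mono
      (le_iSup₂_of_le (f := fun t (_ : t ∈ knownIndices k) => σ t) (Sum.inl k)
        (show k ≤ k from le_rfl) le_rfl) le_rfl
  have hstate := measurable_gossipState k₀ x₀ hmono hpair (fun k => he k _ (hP k))
    (fun k => he k _ (hQ k))
  refine measure_mono_null (fun ω hω => ?_)
    (measure_frequently_inter_never_eq_zero hmono (fun k => iSup₂_le fun t _ => hσle t) he hind
      (M := distinctSelected pair Eplus Eminus k₀ x₀)
      (fun k => measurableSet_distinctSelected (hpair k) (hstate k))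
      (fun k => (hP k).inter (hQ k)) (fun k => (hP k).symmDiff (hQ k))
      (fun k => (disjoint_symmDiff_inf (Eplus k) (Eminus k)).symm)
      (ENNReal.ofReal_pos.2 hε₀) fun k => ofReal_mul_measure_inter_le_measure_symmDiff
        (hgossip.measurableSet_minus k) (hindep k)
        ((hgossip.prob_minus k).trans_le (hminus k)))
  exact ⟨frequently_symmetric_of_consensus hn hx₀ hω.1 hω.2,
    notMem_asymmetric_of_sumPreserved hω.1⟩

theorem theorem7 {n : ℕ} (hn : 3 ≤ n) (hodd : Odd n)
    {Ω : Type*} [MeasurableSpace Ω] (μ : Measure Ω) [IsProbabilityMeasure μ]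
    (A : Matrix (Fin n) (Fin n) ℝ) (hA : A ∈ Matrix.rowStochastic ℝ (Fin n))
    (Pplus Pminus : ℕ → ℝ)
    (pair : ℕ → Ω → Fin n × Fin n) (Eplus Eminus : ℕ → Set Ω)
    (hgossip : IsGossipProcess μ A Pplus Pminus pair Eplus Eminus)
    (hindep : ∀ k, IndepSet (Eplus k) (Eminus k) μ)
    (ε : ℝ) (hε₀ : 0 < ε) (hε₁ : ε < 1)
    (hplus : ∀ k, Pplus k ∈ Set.Icc 0 (1 - ε))
    (hminus : ∀ k, Pminus k ∈ Set.Icc 0 (1 - ε))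
    (k₀ : ℕ) :
    ∀ᵐ x₀ : Fin n → ℝ ∂volume,
      ((∃ ξ : Ω → ℝ, IsConsensusLimit μ pair Eplus Eminus k₀ x₀ ξ) →
        μ (sumPreserved pair Eplus Eminus k₀ x₀) = 0) ∧
      μ (sumPreserved pair Eplus Eminus k₀ x₀ ∩ consensusEvent pair Eplus Eminus k₀ x₀) = 0 := by
  filter_upwards [ae_dyadic_combination_ne_average hn hodd] with x₀ hx₀
  have hnull := measure_sumPreserved_inter_consensusEvent_eq_zero (by omega) hgossip hindep hε₀
    (fun k => (hminus k).2) k₀ hx₀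
  refine ⟨fun ⟨ξ, _, hξ⟩ => ?_, hnull⟩
  rw [← hnull]
  -- If a consensus limit exists, the consensus event has full measure.
  refine measure_congr ?_
  filter_upwards [ae_all_iff.2 hξ] with ω hω
  exact propext (iff_self_and.2 fun _ => ⟨ξ ω, hω⟩)
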